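/- All graphs are finite and simple, and $\rho(G)$ denotes the spectral radius of the adjacency matrix of $G$, i.e. the largest absolute value of its eigenvalues. For $n\ge 5$ let $K_4\bullet K_{1,n-4}$ be the graph of order $n$ obtained by identifying one vertex of the complete graph $K_4$ with the centre of the star $K_{1,n-4}$. Two cycles are edge-disjoint if they have no common edge (they may share vertices). **Theorem 1.3.** Let $G$ be a graph of order $n\ge 17$ with $\rho(G)\ge\rho(K_4\bullet K_{1,n-4})$. Then $G$ contains two edge-disjoint cycles unless $G\cong K_4\bullet K_{1,n-4}$, and the graph $K_4\bullet K_{1,n-4}$ itself does not contain two edge-disjoint cycles. -/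

import Mathlib

open scoped ENNReal

/-- The spectral radius `ρ(G)` of a finite graph: the largest absolute value of an eigenvalue of its
adjacency matrix. (The matrix is real symmetric, so all its eigenvalues are real.) -/
noncomputable def graphSpectralRadius {V : Type*} [Fintype V] (G : SimpleGraph V) : ℝ≥0∞ := by
  classical exact spectralRadius ℝ (G.adjMatrix ℝ)

/-- The coalescence of `G` and `H` obtained by identifying the vertex `v` of `G` with the vertex `w`
of `H`, retaining all edges of both. The identified vertex is represented by `Sum.inl v`. -/
def coalescence {V W : Type*} (G : SimpleGraph V) (v : V) (H : SimpleGraph W) (w : W) :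
    SimpleGraph (V ⊕ {x : W // x ≠ w}) where
  Adj
    | .inl a, .inl b => G.Adj a b
    | .inl a, .inr y => a = v ∧ H.Adj w y
    | .inr x, .inl b => b = v ∧ H.Adj x w
    | .inr x, .inr y => H.Adj x y
  symm := ⟨by
    rintro (a | x) (b | y) h
    · exact SimpleGraph.Adj.symm h
    · exact ⟨h.1, SimpleGraph.Adj.symm h.2⟩
    · exact ⟨h.1, SimpleGraph.Adj.symm h.2⟩
    · exact SimpleGraph.Adj.symm h⟩
  loopless := ⟨by
    rintro (a | x) h
    · exact G.irrefl h
    · exact H.irrefl h⟩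

/-- The graph `K₄ • K_{1,m}`: a vertex of `K₄` is identified with the centre of the star `K_{1,m}`
(the vertex in the part of size `1`). It has `m + 4` vertices. -/
abbrev K4BulletStar (m : ℕ) :
    SimpleGraph (Fin 4 ⊕ {x : Fin 1 ⊕ Fin m // x ≠ Sum.inl 0}) :=
  coalescence (⊤ : SimpleGraph (Fin 4)) 0 (completeBipartiteGraph (Fin 1) (Fin m)) (Sum.inl 0)

/-- `G` contains two cycles that have no edge in common (they may share vertices). -/
def HasTwoEdgeDisjointCycles {V : Type*} (G : SimpleGraph V) : Prop :=
  ∃ (u v : V) (c : G.Walk u u) (d : G.Walk v v),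
    c.IsCycle ∧ d.IsCycle ∧ List.Disjoint c.edges d.edges

/-! If `G` has no two edge-disjoint cycles, deleting the edges of any one cycle leaves a forest, so
all edges off that cycle have the form v – `par v` in a tree rooted wherever convenient. Let `l` be
a root of l²(l-2) = (n-1)(l-2) + 6; it is an eigenvalue of the extremal graph with a positive
eigenvector, and `l ≥ 4.3` is possible because n ≥ 17. From ρ(G) ≥ l comes a nonnegative `x` with l
x ≤ A x and maximum 1 = x(u), whence l‖x‖² ≤ xᵀAx. Root the tree at `u`. Since x(par v) ≤ x(u), the
forest edges contribute no more than a full star at `u`. If the deleted cycle is a triangle avoiding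
`u`, star plus triangle is the form of a `pendantK4`, which is at most l‖x‖²; equality holds
throughout and forces `G` to be that graph. If the triangle passes through `u`, its two edges at `u`
pay for the star edges at p and q, and the tree edges from p and q to their parents, together with
pq, are compared with a triangle p, q, `par p` (`IsTriangleParent`). Without triangles, the
neighbourhood of `u` spans no edge. Applying l x ≤ A x twice at `u` forces large total codegree
between `u` and its non-neighbours, whereas edge-disjointness bounds each codegree by 3 and the
number of edges by n + 3. These bounds are numerically incompatible. -/

/-! ### Cycles, forests and parent functions -/

namespace SimpleGraph

variable {V : Type*} {G : SimpleGraph V}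

/-- Deleting the edges of a cycle from a graph without two edge-disjoint cycles leaves a forest. -/
theorem isAcyclic_deleteEdges_of_isCycle (hG : ¬ HasTwoEdgeDisjointCycles G) {u : V}
    {c : G.Walk u u} (hc : c.IsCycle) : (G.deleteEdges {e | e ∈ c.edges}).IsAcyclic := by
  intro v d hd
  refine hG ⟨u, v, c, d.mapLe (G.deleteEdges_le _), hc, hd.mapLe _, fun e he hed => ?_⟩
  rw [Walk.edges_mapLe_eq_edges] at hed
  have := d.edges_subset_edgeSet hed
  rw [edgeSet_deleteEdges] at this
  exact this.2 he

theorem exists_isCycle_of_triangle {p q r : V} (hpq : G.Adj p q) (hqr : G.Adj q r)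
    (hrp : G.Adj r p) : ∃ c : G.Walk p p, c.IsCycle ∧ c.edges = [s(p, q), s(q, r), s(r, p)] := by
  refine ⟨.cons hpq (.cons hqr (.cons hrp .nil)), ?_, by simp⟩
  have := hpq.ne
  have := hqr.ne
  have := hrp.ne
  rw [Walk.cons_isCycle_iff]
  simp_all [Walk.cons_isPath_iff, eq_comm]

theorem exists_isCycle_of_square {u a w b : V} (hua : G.Adj u a) (haw : G.Adj a w)
    (hwb : G.Adj w b) (hbu : G.Adj b u) (huw : u ≠ w) (hab : a ≠ b) :
    ∃ c : G.Walk u u, c.IsCycle ∧ c.edges = [s(u, a), s(a, w), s(w, b), s(b, u)] := by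
  refine ⟨.cons hua (.cons haw (.cons hwb (.cons hbu .nil))), ?_, by simp⟩
  have := hua.ne
  have := haw.ne
  have := hwb.ne
  have := hbu.ne
  rw [Walk.cons_isCycle_iff]
  simp_all [Walk.cons_isPath_iff, eq_comm]

/-- A forest is contained in a rooted spanning tree, described by its parent function. -/
theorem IsAcyclic.exists_parent {F : SimpleGraph V} (hF : F.IsAcyclic) (u : V) :
    ∃ par : V → V, (∀ v w, F.Adj v w → v ≠ u ∧ par v = w ∨ w ≠ u ∧ par w = v) ∧
      (∀ v, v ≠ u → par v ≠ v) ∧ ∀ v, v ≠ u → par v ≠ u → par (par v) ≠ v := by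
  have : Nonempty V := ⟨u⟩
  obtain ⟨T, hFT, -, hT⟩ :=
    (connected_top (V := V)).exists_isTree_le_of_le_of_isAcyclic le_top hF
  choose p hp using fun v => (hT.existsUnique_path u v).exists
  have hnil : ∀ v, v ≠ u → ¬ (p v).Nil := fun v hv h => hv h.eq.symm
  have hpar : ∀ v, v ≠ u → T.Adj (p v).penultimate v := fun v hv =>
    (p v).adj_penultimate (hnil v hv)
  have key : ∀ v w, T.Adj v w → w ∈ (p v).support → v ≠ u ∧ (p v).penultimate = w := by
    intro v w hvw hw
    refine ⟨?_, (hT.isAcyclic.eq_penultimate_of_adj_end (hp v) hvw hw).symm⟩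
    rintro rfl
    rw [((p v).isPath_iff_nil.mp (hp v)).eq_nil] at hw
    exact hvw.ne' (by simpa using hw)
  -- The parent of v is the vertex before v on the tree path from `u`; at `u` itself this is a
  -- default value, hence the conditions v ≠ u. Of two adjacent vertices, one lies on the root path
  -- of the other.
  refine ⟨fun v => (p v).penultimate, fun v w hvw => ?_, fun v hv => (hpar v hv).ne,
    fun v hv hw h => ?_⟩
  · by_cases hw : w ∈ (p v).support
    · exact .inl (key v w (hFT hvw) hw)
    · exact .inr (key w v (hFT hvw).symm
        (hT.isAcyclic.mem_support_of_ne_mem_support_of_adj_of_isPath (hp w) (hp v)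
          (hFT hvw).symm hw))
  · refine hT.isAcyclic.ne_mem_support_of_support_of_adj_of_isPath (hp v) (hp _)
      (hpar v hv).symm ((p v).getVert_mem_support _) ?_
    have h2 : (p (p v).penultimate).penultimate ∈ (p (p v).penultimate).support :=
      Walk.getVert_mem_support _ _
    dsimp only at h
    rwa [h] at h2

end SimpleGraph

/-! ### Quadratic forms and the spectral radius -/

namespace SimpleGraph

variable {V : Type*}

open Classical in
/-- The real adjacency weight of a pair of vertices. -/
noncomputable def adjWeight (G : SimpleGraph V) (v w : V) : ℝ := if G.Adj v w then 1 else 0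

section adjWeight

variable {G : SimpleGraph V} {v w : V}

theorem adjWeight_of_adj (h : G.Adj v w) : G.adjWeight v w = 1 := if_pos h

theorem adjWeight_of_not_adj (h : ¬ G.Adj v w) : G.adjWeight v w = 0 := if_neg h

theorem adjWeight_nonneg (G : SimpleGraph V) (v w : V) : 0 ≤ G.adjWeight v w := by
  unfold adjWeight; split_ifs <;> norm_num

theorem adjWeight_le_one (G : SimpleGraph V) (v w : V) : G.adjWeight v w ≤ 1 := by
  unfold adjWeight; split_ifs <;> norm_num

theorem adjWeight_comm (G : SimpleGraph V) (v w : V) : G.adjWeight v w = G.adjWeight w v := by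
  by_cases h : G.Adj v w
  · rw [adjWeight_of_adj h, adjWeight_of_adj h.symm]
  · rw [adjWeight_of_not_adj h, adjWeight_of_not_adj fun h' => h h'.symm]

theorem adjWeight_ne_zero : G.adjWeight v w ≠ 0 ↔ G.Adj v w := by
  unfold adjWeight; split_ifs with h <;> simp [h]

end adjWeight

/-- Collatz–Wielandt bound: a positive eigenvector bounds the quadratic form, and equality forces
proportionality along edges. -/
theorem sum_mul_le_of_pos_eigenvector [Fintype V] {A : V → V → ℝ} (hA : ∀ v w, 0 ≤ A v w)
    (hsymm : ∀ v w, A v w = A w v) {l : ℝ} {y : V → ℝ} (hy : ∀ v, 0 < y v)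
    (hAy : ∀ v, ∑ w, A v w * y w = l * y v) (x : V → ℝ) :
    ∑ v, ∑ w, A v w * (x v * x w) ≤ l * ∑ v, x v ^ 2 ∧
      (∑ v, ∑ w, A v w * (x v * x w) = l * ∑ v, x v ^ 2 →
        ∀ v w, A v w ≠ 0 → x v * y w = x w * y v) := by
  have h1 : ∑ v, ∑ w, A v w * (y w / y v * x v ^ 2) = l * ∑ v, x v ^ 2 := by
    rw [Finset.mul_sum]
    refine Finset.sum_congr rfl fun v _ => ?_
    have : ∑ w, A v w * (y w / y v * x v ^ 2) = (∑ w, A v w * y w) * (x v ^ 2 / y v) := by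
      rw [Finset.sum_mul]
      exact Finset.sum_congr rfl fun w _ => by ring
    rw [this, hAy]
    have := (hy v).ne'
    field_simp
  have h2 : ∑ v, ∑ w, A v w * (y v / y w * x w ^ 2) = l * ∑ v, x v ^ 2 := by
    rw [← h1, Finset.sum_comm]
    exact Finset.sum_congr rfl fun v _ => Finset.sum_congr rfl fun w _ => by rw [hsymm]
  -- Summed over all pairs, these weighted squares give twice the gap l‖x‖² - xᵀAx.
  have hterm : ∀ v w, A v w * (y v * y w * (x v / y v - x w / y w) ^ 2) =
      A v w * (y w / y v * x v ^ 2) + A v w * (y v / y w * x w ^ 2) -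
        2 * (A v w * (x v * x w)) := by
    intro v w
    have := (hy v).ne'
    have := (hy w).ne'
    field_simp
    ring
  have hnn : ∀ v w, 0 ≤ A v w * (y v * y w * (x v / y v - x w / y w) ^ 2) := fun v w =>
    mul_nonneg (hA v w) (mul_nonneg (mul_pos (hy v) (hy w)).le (sq_nonneg _))
  have hsum : ∑ v, ∑ w, A v w * (y v * y w * (x v / y v - x w / y w) ^ 2) =
      2 * (l * ∑ v, x v ^ 2 - ∑ v, ∑ w, A v w * (x v * x w)) := by
    simp only [hterm, Finset.sum_sub_distrib, Finset.sum_add_distrib, h1, h2, ← Finset.mul_sum]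
    ring
  have hpos : 0 ≤ ∑ v, ∑ w, A v w * (y v * y w * (x v / y v - x w / y w) ^ 2) :=
    Finset.sum_nonneg fun v _ => Finset.sum_nonneg fun w _ => hnn v w
  refine ⟨by linarith, fun heq v w hvw => ?_⟩
  rw [heq, sub_self, mul_zero, Finset.sum_eq_zero_iff_of_nonneg
    (fun v _ => Finset.sum_nonneg fun w _ => hnn v w)] at hsum
  have h3 := (Finset.sum_eq_zero_iff_of_nonneg (fun w _ => hnn v w)).mp (hsum v (Finset.mem_univ _))
    w (Finset.mem_univ _)
  have h4 : x v / y v - x w / y w = 0 := by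
    have h5 := mul_ne_zero (hy v).ne' (hy w).ne'
    exact pow_eq_zero_iff two_ne_zero |>.mp
      ((mul_eq_zero.mp ((mul_eq_zero.mp h3).resolve_left hvw)).resolve_left h5)
  have := (hy v).ne'
  have := (hy w).ne'
  field_simp at h4
  linarith

theorem ofReal_le_graphSpectralRadius [Fintype V] {G : SimpleGraph V} {l : ℝ} {y : V → ℝ}
    (hl : 0 ≤ l) (hy : y ≠ 0) (h : ∀ v, ∑ w, G.adjWeight v w * y w = l * y v) :
    ENNReal.ofReal l ≤ graphSpectralRadius G := by
  classical
  unfold graphSpectralRadius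
  have hmem : l ∈ spectrum ℝ (G.adjMatrix ℝ) := by
    rw [← Matrix.spectrum_toLin', ← Module.End.hasEigenvalue_iff_mem_spectrum]
    refine Module.End.hasEigenvalue_of_hasEigenvector (x := y)
      ⟨Module.End.mem_eigenspace_iff.mpr ?_, hy⟩
    ext v
    rw [Matrix.toLin'_apply, Pi.smul_apply, smul_eq_mul, ← h v, Matrix.mulVec, dotProduct]
    refine Finset.sum_congr rfl fun w _ => ?_
    rw [adjMatrix_apply, adjWeight]
  have h2 : ENNReal.ofReal l = ‖l‖₊ := by
    rw [ENNReal.ofReal, ENNReal.coe_inj, Real.toNNReal_eq_nnnorm_of_nonneg hl]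
  rw [h2]
  exact le_iSup₂ (f := fun (k : ℝ) (_ : k ∈ spectrum ℝ (G.adjMatrix ℝ)) => (‖k‖₊ : ℝ≥0∞)) l hmem

/-- A lower bound on the spectral radius gives a nonnegative subinvariant vector. -/
theorem exists_subinvariant_vector [Fintype V] {G : SimpleGraph V} {l : ℝ} (hl : 0 < l)
    (h : ENNReal.ofReal l ≤ graphSpectralRadius G) :
    ∃ (x : V → ℝ) (u : V), (∀ v, 0 ≤ x v) ∧ x u = 1 ∧ (∀ v, x v ≤ 1) ∧
      ∀ v, l * x v ≤ ∑ w, G.adjWeight v w * x w := by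
  classical
  unfold graphSpectralRadius at h
  obtain ⟨k, hk, hlk⟩ : ∃ k ∈ spectrum ℝ (G.adjMatrix ℝ), l ≤ |k| := by
    by_contra! hcon
    have hfin := Matrix.finite_spectrum (G.adjMatrix ℝ)
    have h2 : spectralRadius ℝ (G.adjMatrix ℝ) < ENNReal.ofReal l := by
      have h3 : spectralRadius ℝ (G.adjMatrix ℝ) = hfin.toFinset.sup fun k => (‖k‖₊ : ℝ≥0∞) := by
        simp [spectralRadius, Finset.sup_eq_iSup]
      rw [h3, Finset.sup_lt_iff (by simpa using hl)]
      intro k hk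
      have h4 := hcon k (by simpa using hk)
      have h5 : (‖k‖₊ : ℝ≥0∞) = ENNReal.ofReal |k| := by
        rw [ENNReal.ofReal, ENNReal.coe_inj, Real.toNNReal_abs]; rfl
      rw [h5]
      exact (ENNReal.ofReal_lt_ofReal_iff hl).mpr h4
    exact absurd h h2.not_ge
  rw [← Matrix.spectrum_toLin', ← Module.End.hasEigenvalue_iff_mem_spectrum] at hk
  obtain ⟨z, hz, hz0⟩ := hk.exists_hasEigenvector
  rw [Module.End.mem_eigenspace_iff] at hz
  have hzv : ∀ v, ∑ w, G.adjWeight v w * z w = k * z v := by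
    intro v
    have := congrFun hz v
    rw [Matrix.toLin'_apply, Pi.smul_apply, smul_eq_mul, Matrix.mulVec, dotProduct] at this
    rw [← this]
    exact Finset.sum_congr rfl fun w _ => by rw [adjMatrix_apply, adjWeight]
  obtain ⟨v0, hv0⟩ := Function.ne_iff.mp hz0
  obtain ⟨u, -, hu⟩ := Finset.exists_max_image Finset.univ (fun v => |z v|) ⟨v0, Finset.mem_univ _⟩
  have hpos : 0 < |z u| := (abs_pos.mpr hv0).trans_le (hu v0 (Finset.mem_univ _))
  refine ⟨fun v => |z v| / |z u|, u, fun v => by positivity, div_self hpos.ne', fun v =>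
    (div_le_one hpos).mpr (hu v (Finset.mem_univ _)), fun v => ?_⟩
  -- The eigenvalue `k` may be negative; the triangle inequality makes |z| subinvariant in either
  -- case.
  have h1 : l * |z v| ≤ ∑ w, G.adjWeight v w * |z w| := by
    calc l * |z v| ≤ |k| * |z v| := by gcongr
      _ = |∑ w, G.adjWeight v w * z w| := by rw [hzv, abs_mul]
      _ ≤ ∑ w, |G.adjWeight v w * z w| := Finset.abs_sum_le_sum_abs _ _
      _ = ∑ w, G.adjWeight v w * |z w| := Finset.sum_congr rfl fun w _ => by
        rw [abs_mul, abs_of_nonneg (adjWeight_nonneg _ _ _)]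
  calc l * (|z v| / |z u|) = l * |z v| / |z u| := by ring
    _ ≤ (∑ w, G.adjWeight v w * |z w|) / |z u| := by gcongr
    _ = ∑ w, G.adjWeight v w * (|z w| / |z u|) := by
      rw [Finset.sum_div]
      exact Finset.sum_congr rfl fun w _ => by ring

end SimpleGraph

/-! ### The extremal graph -/

namespace SimpleGraph

variable {V : Type*}

/-- The graph on `V` in which `u` is adjacent to every other vertex and the only further edges are
those of the triangle `a b c`. -/
def pendantK4 (u a b c : V) : SimpleGraph V where
  Adj v w := v ≠ w ∧ (v = u ∨ w = u ∨ (v = a ∨ v = b ∨ v = c) ∧ (w = a ∨ w = b ∨ w = c))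
  symm := ⟨fun _ _ h => ⟨h.1.symm, by tauto⟩⟩
  loopless := ⟨fun _ h => h.1 rfl⟩

theorem pendantK4_adj {u a b c v w : V} : (pendantK4 u a b c).Adj v w ↔
    v ≠ w ∧ (v = u ∨ w = u ∨ (v = a ∨ v = b ∨ v = c) ∧ (w = a ∨ w = b ∨ w = c)) := Iff.rfl

/-- The vertices `u, a, b, c` are distinct. -/
def Distinct4 (u a b c : V) : Prop := u ≠ a ∧ u ≠ b ∧ u ≠ c ∧ a ≠ b ∧ a ≠ c ∧ b ≠ c

-- Every row contains `f u`, corrected at the four special vertices. The row of `u` subtracts `2 * f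
-- u`: once for the common term, once because `u` is not its own neighbour.
open Classical in
theorem sum_adjWeight_pendantK4 [Fintype V] {u a b c : V} (h : Distinct4 u a b c) (f : V → ℝ)
    (v : V) : ∑ w, (pendantK4 u a b c).adjWeight v w * f w =
      f u + (if v = u then ∑ w, f w - 2 * f u else 0) + (if v = a then f b + f c else 0) +
        (if v = b then f a + f c else 0) + (if v = c then f a + f b else 0) := by
  obtain ⟨hua, hub, huc, hab, hac, hbc⟩ := h
  have hsum : ∀ z : V, f z = ∑ w, if w = z then f w else 0 := fun z => by simp
  have key : ∀ w, (pendantK4 u a b c).adjWeight v w * f w =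
      (if w = u then f w else 0) +
      (if v = u then f w - 2 * (if w = u then f w else 0) else 0) +
      (if v = a then (if w = b then f w else 0) + (if w = c then f w else 0) else 0) +
      (if v = b then (if w = a then f w else 0) + (if w = c then f w else 0) else 0) +
      (if v = c then (if w = a then f w else 0) + (if w = b then f w else 0) else 0) := by
    intro w
    unfold adjWeight
    simp only [pendantK4_adj]
    by_cases h1 : v = u <;> by_cases h2 : v = a <;> by_cases h3 : v = b <;> by_cases h4 : v = c <;>
    by_cases k1 : w = u <;> by_cases k2 : w = a <;> by_cases k3 : w = b <;> by_cases k4 : w = c <;>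
    first
    | (exfalso; simp_all; done)
    | (by_cases hvw : v = w
       · subst hvw; simp_all <;> ring
       · simp_all)
  simp only [key, Finset.sum_add_distrib]
  split_ifs <;> simp [Finset.sum_add_distrib, Finset.sum_sub_distrib]

/-- The quadratic form of `pendantK4 u a b c`. -/
theorem sum_adjWeight_pendantK4_mul [Fintype V] {u a b c : V} (h : Distinct4 u a b c)
    (x : V → ℝ) : ∑ v, ∑ w, (pendantK4 u a b c).adjWeight v w * (x v * x w) =
      2 * (x u * (∑ v, x v - x u) + x a * x b + x b * x c + x a * x c) := by
  classical
  have h1 : ∀ v, ∑ w, (pendantK4 u a b c).adjWeight v w * (x v * x w) =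
      x v * x u + (if v = u then x v * (∑ w, x w - 2 * x u) else 0) +
        (if v = a then x v * (x b + x c) else 0) + (if v = b then x v * (x a + x c) else 0) +
        (if v = c then x v * (x a + x b) else 0) := by
    intro v
    have : ∑ w, (pendantK4 u a b c).adjWeight v w * (x v * x w) =
        x v * ∑ w, (pendantK4 u a b c).adjWeight v w * x w := by
      rw [Finset.mul_sum]
      exact Finset.sum_congr rfl fun w _ => by ring
    rw [this, sum_adjWeight_pendantK4 h]
    split_ifs <;> ring
  simp only [h1, Finset.sum_add_distrib, Finset.sum_ite_eq', Finset.mem_univ, if_true,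
    ← Finset.sum_mul]
  ring

open Classical in
/-- The Perron vector of `pendantK4 u a b c` for the eigenvalue `l`, normalized at `u`. -/
noncomputable def pendantK4Vector (u a b c : V) (l : ℝ) (v : V) : ℝ :=
  if v = u then 1 else if v = a ∨ v = b ∨ v = c then 1 / (l - 2) else 1 / l

theorem pendantK4Vector_pos {u a b c : V} {l : ℝ} (hl : 2 < l) (v : V) :
    0 < pendantK4Vector u a b c l v := by
  unfold pendantK4Vector
  have : 0 < l - 2 := by linarith
  have : 0 < l := by linarith
  split_ifs <;> positivity

/-- Off `u` the equations are 1 + 2/(l-2) = l/(l-2) and 1 = l · (1/l). The one at `u` reads l =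
3/(l-2) + (n-4)/l, which is `hroot` after clearing denominators. -/
theorem pendantK4Vector_eigen [Fintype V] {u a b c : V} (h : Distinct4 u a b c) {l : ℝ}
    (hl : 2 < l) (hroot : l ^ 2 * (l - 2) = (Fintype.card V - 1) * (l - 2) + 6) (v : V) :
    ∑ w, (pendantK4 u a b c).adjWeight v w * pendantK4Vector u a b c l w =
      l * pendantK4Vector u a b c l v := by
  classical
  have hl2 : l - 2 ≠ 0 := by linarith
  have hl0 : l ≠ 0 := by linarith
  rw [sum_adjWeight_pendantK4 h]
  obtain ⟨hua, hub, huc, hab, hac, hbc⟩ := h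
  have hu : pendantK4Vector u a b c l u = 1 := by simp [pendantK4Vector]
  have ha : pendantK4Vector u a b c l a = 1 / (l - 2) := by simp [pendantK4Vector, hua.symm]
  have hb : pendantK4Vector u a b c l b = 1 / (l - 2) := by simp [pendantK4Vector, hub.symm]
  have hc : pendantK4Vector u a b c l c = 1 / (l - 2) := by simp [pendantK4Vector, huc.symm]
  have hsum : ∑ w, pendantK4Vector u a b c l w =
      Fintype.card V / l + (1 - 1 / l) + 3 * (1 / (l - 2) - 1 / l) := by
    have : ∀ w, pendantK4Vector u a b c l w = 1 / l + (if w = u then 1 - 1 / l else 0) +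
        (if w = a then 1 / (l - 2) - 1 / l else 0) + (if w = b then 1 / (l - 2) - 1 / l else 0) +
        (if w = c then 1 / (l - 2) - 1 / l else 0) := by
      intro w
      by_cases k1 : w = u
      · subst k1; simp_all
      by_cases k2 : w = a
      · subst k2; simp_all
      by_cases k3 : w = b
      · subst k3; simp_all
      by_cases k4 : w = c
      · subst k4; simp_all
      simp [pendantK4Vector, *]
    simp only [this, Finset.sum_add_distrib, Finset.sum_ite_eq', Finset.mem_univ, if_true,
      Finset.sum_const, Finset.card_univ, nsmul_eq_mul]
    ring
  rw [hsum, hu, ha, hb, hc]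
  by_cases k1 : v = u
  · subst k1
    simp only [hua, hub, huc, if_true, if_false, hu]
    field_simp
    linarith
  by_cases k2 : v = a
  · subst k2
    simp only [hua.symm, hab, hac, if_true, if_false, ha]
    field_simp
    ring
  by_cases k3 : v = b
  · subst k3
    simp only [hub.symm, hab.symm, hbc, if_true, if_false, hb]
    field_simp
    ring
  by_cases k4 : v = c
  · subst k4
    simp only [huc.symm, hac.symm, hbc.symm, if_true, if_false, hc]
    field_simp
    ring
  have hv : pendantK4Vector u a b c l v = 1 / l := by simp [pendantK4Vector, *]
  simp only [k1, k2, k3, k4, if_false, hv]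
  field_simp
  ring

/-- The eigenvalue equation of `pendantK4` on `n` vertices has a root which is at least `4.3`. -/
theorem exists_pendantK4_root {n : ℝ} (hn : 17 ≤ n) :
    ∃ l : ℝ, 4.3 ≤ l ∧ l ^ 2 * (l - 2) = (n - 1) * (l - 2) + 6 := by
  have hcont : ContinuousOn (fun l : ℝ => l ^ 2 * (l - 2) - ((n - 1) * (l - 2) + 6))
      (Set.Icc 4.3 n) := by fun_prop
  -- At l = 4.3 the left side is 42.527, while the right side is at least 42.8, its value for n =
  -- 17.
  obtain ⟨l, hl, h0⟩ := intermediate_value_Icc (by linarith) hcont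
    (show (0 : ℝ) ∈ Set.Icc _ _ from ⟨by norm_num; linarith, by nlinarith [sq_nonneg n]⟩)
  exact ⟨l, hl.1, by simpa [sub_eq_zero] using h0⟩

theorem ofReal_le_graphSpectralRadius_pendantK4 [Fintype V] {u a b c : V}
    (h : Distinct4 u a b c) {l : ℝ} (hl : 2 < l)
    (hroot : l ^ 2 * (l - 2) = (Fintype.card V - 1) * (l - 2) + 6) :
    ENNReal.ofReal l ≤ graphSpectralRadius (pendantK4 u a b c) := by
  refine ofReal_le_graphSpectralRadius (by linarith) (fun h0 => ?_) (pendantK4Vector_eigen h hl hroot)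
  exact (pendantK4Vector_pos (a := a) (b := b) (c := c) hl u).ne' (congrFun h0 u)

/-- The Rayleigh bound for `pendantK4`, with its equality case. -/
theorem pendantK4_rayleigh [Fintype V] {u a b c : V} (h : Distinct4 u a b c) {l : ℝ}
    (hl : 2 < l) (hroot : l ^ 2 * (l - 2) = (Fintype.card V - 1) * (l - 2) + 6) {x : V → ℝ}
    (hxu : x u = 1) :
    2 * (x u * (∑ v, x v - x u) + x a * x b + x b * x c + x a * x c) ≤ l * ∑ v, x v ^ 2 ∧
      (2 * (x u * (∑ v, x v - x u) + x a * x b + x b * x c + x a * x c) = l * ∑ v, x v ^ 2 →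
        x = pendantK4Vector u a b c l) := by
  have := sum_mul_le_of_pos_eigenvector (adjWeight_nonneg _) (adjWeight_comm _)
    (pendantK4Vector_pos hl) (pendantK4Vector_eigen h hl hroot) x
  rw [sum_adjWeight_pendantK4_mul h] at this
  refine ⟨this.1, fun heq => funext fun v => ?_⟩
  have hu : pendantK4Vector u a b c l u = 1 := by simp [pendantK4Vector]
  by_cases hv : v = u
  · rw [hv, hxu, hu]
  · have := this.2 heq u v (adjWeight_ne_zero.mpr ⟨Ne.symm hv, .inl rfl⟩)
    rw [hxu, hu] at this
    linarith

theorem K4BulletStar_eq_pendantK4 (m : ℕ) : K4BulletStar m =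
    pendantK4 (.inl 0) (.inl 1) (.inl 2) (.inl 3) := by
  have hx : ∀ x : {x : Fin 1 ⊕ Fin m // x ≠ Sum.inl 0}, ∃ i, x.1 = Sum.inr i := by
    rintro ⟨i | i, hi⟩
    · exact absurd (congrArg _ (Subsingleton.elim i 0)) hi
    · exact ⟨i, rfl⟩
  ext v w
  rw [pendantK4_adj]
  rcases v with a | x <;> rcases w with b | y
  · simp only [coalescence, top_adj, ne_eq, Sum.inl.injEq]
    fin_cases a <;> fin_cases b <;> simp
  · obtain ⟨i, hi⟩ := hx y
    simp [coalescence, hi]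
  · obtain ⟨i, hi⟩ := hx x
    simp [coalescence, hi]
  · obtain ⟨i, hi⟩ := hx x
    obtain ⟨j, hj⟩ := hx y
    simp [coalescence, hi, hj]

theorem distinct4_K4BulletStar (m : ℕ) :
    Distinct4 (V := Fin 4 ⊕ {x : Fin 1 ⊕ Fin m // x ≠ Sum.inl 0})
      (.inl 0) (.inl 1) (.inl 2) (.inl 3) := by
  simp [Distinct4]

theorem card_K4BulletStar (m : ℕ) :
    Fintype.card (Fin 4 ⊕ {x : Fin 1 ⊕ Fin m // x ≠ Sum.inl 0}) = m + 4 := by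
  rw [Fintype.card_sum, Fintype.card_subtype_compl]
  simp
  omega

/-- Any two graphs `pendantK4` of the same order are isomorphic. -/
theorem nonempty_pendantK4_iso {W : Type*} [Fintype V] [Fintype W] {u a b c : V}
    {u' a' b' c' : W} (h : Distinct4 u a b c) (h' : Distinct4 u' a' b' c')
    (hcard : Fintype.card V = Fintype.card W) :
    Nonempty (pendantK4 u a b c ≃g pendantK4 u' a' b' c') := by
  classical
  obtain ⟨hua, hub, huc, hab, hac, hbc⟩ := h
  obtain ⟨hua', hub', huc', hab', hac', hbc'⟩ := h'
  let f : Fin 4 → V := ![u, a, b, c]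
  let g : Fin 4 → W := ![u', a', b', c']
  have hf : Function.Injective f := by
    intro i j hij
    fin_cases i <;> fin_cases j <;> simp_all [f]
  have hg : Function.Injective g := by
    intro i j hij
    fin_cases i <;> fin_cases j <;> simp_all [g]
  let e0 : V ≃ W := Fintype.equivOfCardEq hcard
  -- `Equiv.extendSubtype` extends a bijection between subsets of a single finite type, so the four
  -- target vertices are first pulled back to `V`.
  let e1 : {v // v ∈ Set.range f} ≃ {w // w ∈ Set.range (e0.symm ∘ g)} :=
    (Equiv.ofInjective f hf).symm.trans (Equiv.ofInjective _ (e0.symm.injective.comp hg))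
  let e : V ≃ W := e1.extendSubtype.trans e0
  have he : ∀ i, e (f i) = g i := by
    intro i
    simp only [e, Equiv.trans_apply]
    rw [Equiv.extendSubtype_apply_of_mem _ _ ⟨i, rfl⟩]
    simp only [e1, Equiv.trans_apply]
    rw [Equiv.ofInjective_symm_apply]
    simp
  have e1 : ∀ v, e v = u' ↔ v = u := fun v => by
    rw [← show e u = u' from he 0]; exact e.injective.eq_iff
  have e2 : ∀ v, e v = a' ↔ v = a := fun v => by
    rw [← show e a = a' from he 1]; exact e.injective.eq_iff
  have e3 : ∀ v, e v = b' ↔ v = b := fun v => by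
    rw [← show e b = b' from he 2]; exact e.injective.eq_iff
  have e4 : ∀ v, e v = c' ↔ v = c := fun v => by
    rw [← show e c = c' from he 3]; exact e.injective.eq_iff
  exact ⟨⟨e, fun {v w} => by simp [pendantK4_adj, e1, e2, e3, e4]⟩⟩

/-- The graph `pendantK4 u a b c` does not contain two edge-disjoint cycles. -/
theorem not_hasTwoEdgeDisjointCycles_pendantK4 {u a b c : V} (h : Distinct4 u a b c) :
    ¬ HasTwoEdgeDisjointCycles (pendantK4 u a b c) := by
  classical
  obtain ⟨hua, hub, huc, hab, hac, hbc⟩ := h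
  rintro ⟨v, w, C, D, hC, hD, hdisj⟩
  -- A vertex on a cycle has two neighbours along it, so pendant vertices lie on no cycle and every
  -- cycle stays inside `K`.
  have hnbr : ∀ {v : V} {C : (pendantK4 u a b c).Walk v v}, C.IsCycle → ∀ z ∈ C.support,
      ∃ y y', y ≠ y' ∧ s(z, y) ∈ C.edges ∧ s(z, y') ∈ C.edges := by
    intro v C hC z hz
    obtain ⟨y, y', hne, hset⟩ := Set.ncard_eq_two.mp (hC.ncard_neighborSet_toSubgraph_eq_two hz)
    refine ⟨y, y', hne, ?_, ?_⟩
    · rw [← Walk.adj_toSubgraph_iff_mem_edges, ← Subgraph.mem_neighborSet, hset]; simp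
    · rw [← Walk.adj_toSubgraph_iff_mem_edges, ← Subgraph.mem_neighborSet, hset]; simp
  let K : Finset V := {u, a, b, c}
  have hK : ∀ {v : V} {C : (pendantK4 u a b c).Walk v v}, C.IsCycle → ∀ z ∈ C.support, z ∈ K := by
    intro v C hC z hz
    by_contra hzK
    simp only [K, Finset.mem_insert, Finset.mem_singleton, not_or] at hzK
    obtain ⟨y, y', hne, hy, hy'⟩ := hnbr hC z hz
    have h1 := C.adj_of_mem_edges hy
    have h2 := C.adj_of_mem_edges hy'
    rw [pendantK4_adj] at h1 h2
    have h3 : y = u := by tauto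
    have h4 : y' = u := by tauto
    exact hne (h3.trans h4.symm)
  have hcard : ∀ {v : V} {C : (pendantK4 u a b c).Walk v v}, C.IsCycle →
      3 ≤ C.support.toFinset.card := by
    intro v C hC
    have h1 := hC.three_le_length
    have h2 : C.support.tail.toFinset.card = C.length := by
      rw [List.toFinset_card_of_nodup hC.support_nodup]; simp
    have h3 : C.support.tail.toFinset ⊆ C.support.toFinset := fun z hz =>
      List.mem_toFinset.mpr (List.mem_of_mem_tail (List.mem_toFinset.mp hz))
    have := Finset.card_le_card h3
    omega
  have hKcard : K.card ≤ 4 := Finset.card_le_four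
  -- Two sets of at least three vertices among four must meet. At a common vertex, disjoint edge
  -- sets would require four distinct neighbours, hence five vertices in `K`.
  obtain ⟨z, hz⟩ : (C.support.toFinset ∩ D.support.toFinset).Nonempty := by
    rw [Finset.nonempty_iff_ne_empty]
    intro h0
    have h1 := Finset.card_union_add_card_inter C.support.toFinset D.support.toFinset
    have h2 : C.support.toFinset ∪ D.support.toFinset ⊆ K := by
      intro y hy
      rw [Finset.mem_union, List.mem_toFinset, List.mem_toFinset] at hy
      exact hy.elim (hK hC y) (hK hD y)
    have := Finset.card_le_card h2
    have := hcard hC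
    have := hcard hD
    rw [h0, Finset.card_empty] at h1
    omega
  rw [Finset.mem_inter, List.mem_toFinset, List.mem_toFinset] at hz
  obtain ⟨y1, y2, h12, hy1, hy2⟩ := hnbr hC z hz.1
  obtain ⟨y3, y4, h34, hy3, hy4⟩ := hnbr hD z hz.2
  have hne : ∀ {y y'}, s(z, y) ∈ C.edges → s(z, y') ∈ D.edges → y ≠ y' := by
    rintro y _ hy hy' rfl
    exact hdisj hy hy'
  have hsub : ({z, y1, y2, y3, y4} : Finset V) ⊆ K := by
    intro y hy
    simp only [Finset.mem_insert, Finset.mem_singleton] at hy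
    rcases hy with rfl | rfl | rfl | rfl | rfl
    · exact hK hC _ hz.1
    · exact hK hC _ (C.snd_mem_support_of_mem_edges hy1)
    · exact hK hC _ (C.snd_mem_support_of_mem_edges hy2)
    · exact hK hD _ (D.snd_mem_support_of_mem_edges hy3)
    · exact hK hD _ (D.snd_mem_support_of_mem_edges hy4)
  have h5 : ({z, y1, y2, y3, y4} : Finset V).card = 5 := by
    have := (C.adj_of_mem_edges hy1).ne
    have := (C.adj_of_mem_edges hy2).ne
    have := (D.adj_of_mem_edges hy3).ne
    have := (D.adj_of_mem_edges hy4).ne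
    have := hne hy1 hy3
    have := hne hy1 hy4
    have := hne hy2 hy3
    have := hne hy2 hy4
    rw [Finset.card_eq_succ]
    refine ⟨z, {y1, y2, y3, y4}, by simp [*], rfl, ?_⟩
    rw [Finset.card_eq_succ]
    refine ⟨y1, {y2, y3, y4}, by simp [*], rfl, ?_⟩
    rw [Finset.card_eq_three]
    exact ⟨y2, y3, y4, by assumption, by assumption, by assumption, rfl⟩
  have := Finset.card_le_card hsub
  omega

end SimpleGraph

/-! ### Comparison with the form of the extremal graph -/

namespace SimpleGraph

variable {V : Type*} {G : SimpleGraph V}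

/-- In a graph without two edge-disjoint cycles, every edge outside a given cycle joins a vertex to
its parent in a suitable rooted spanning tree. -/
theorem exists_parent_of_isCycle (hG : ¬ HasTwoEdgeDisjointCycles G) {z : V} {C : G.Walk z z}
    (hC : C.IsCycle) (u : V) :
    ∃ par : V → V, (∀ v w, G.Adj v w →
        (v ≠ u ∧ par v = w ∨ w ≠ u ∧ par w = v) ∨ s(v, w) ∈ C.edges) ∧
      (∀ v, v ≠ u → par v ≠ v) ∧ ∀ v, v ≠ u → par v ≠ u → par (par v) ≠ v := by
  obtain ⟨par, h1, h2, h3⟩ := (isAcyclic_deleteEdges_of_isCycle hG hC).exists_parent u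
  refine ⟨par, fun v w hvw => ?_, h2, h3⟩
  by_cases h : s(v, w) ∈ C.edges
  · exact .inr h
  · exact .inl (h1 v w (by rw [deleteEdges_adj]; exact ⟨hvw, h⟩))

/-- The quadratic form of a graph whose edges are covered by a parent function and a set `S` of
further pairs. -/
theorem sum_adjWeight_mul_le_of_cover [Fintype V] [DecidableEq V] {u : V} {par : V → V} {S : Finset (V × V)}
    (hcover : ∀ v w, G.Adj v w →
      (v ≠ u ∧ par v = w ∨ w ≠ u ∧ par w = v) ∨ (v, w) ∈ S ∨ (w, v) ∈ S)
    {x : V → ℝ} (hx : ∀ v, 0 ≤ x v) :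
    ∑ v, ∑ w, G.adjWeight v w * (x v * x w) ≤
      2 * (∑ v ∈ Finset.univ.erase u, x v * x (par v) + ∑ s ∈ S, x s.1 * x s.2) := by
  -- Each adjacent ordered pair is charged to `I v w` or `I w v`. Charged pairs need not be edges,
  -- which is why only an inequality results.
  let I : V → V → ℝ := fun v w =>
    (if v ≠ u ∧ par v = w then x v * x w else 0) + if (v, w) ∈ S then x v * x w else 0
  have hI : ∀ v w, 0 ≤ I v w := fun v w => by
    have := mul_nonneg (hx v) (hx w)
    simp only [I]
    split_ifs <;> linarith
  have hle : ∀ v w, G.adjWeight v w * (x v * x w) ≤ I v w + I w v := by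
    intro v w
    have h0 := mul_nonneg (hx v) (hx w)
    by_cases hvw : G.Adj v w
    · rw [adjWeight_of_adj hvw, one_mul]
      have key : ∀ v w, (v ≠ u ∧ par v = w ∨ (v, w) ∈ S) → x v * x w ≤ I v w := by
        intro v w h
        have h0 := mul_nonneg (hx v) (hx w)
        rcases h with h | h
        · simp only [I, if_pos h]; split_ifs <;> linarith
        · simp only [I, if_pos h]; split_ifs <;> linarith
      rcases hcover v w hvw with (h | h) | h | h
      · linarith [key v w (.inl h), hI w v]
      · linarith [key w v (.inl h), hI v w, mul_comm (x v) (x w)]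
      · linarith [key v w (.inr h), hI w v]
      · linarith [key w v (.inr h), hI v w, mul_comm (x v) (x w)]
    · rw [adjWeight_of_not_adj hvw, zero_mul]
      exact add_nonneg (hI _ _) (hI _ _)
  have hsumI : ∑ v, ∑ w, I v w =
      ∑ v ∈ Finset.univ.erase u, x v * x (par v) + ∑ s ∈ S, x s.1 * x s.2 := by
    simp only [I, Finset.sum_add_distrib]
    congr 1
    · rw [← Finset.filter_ne' Finset.univ u, Finset.sum_filter]
      refine Finset.sum_congr rfl fun v _ => ?_
      by_cases hv : v = u <;> simp [hv]
    · rw [← Finset.sum_product' Finset.univ Finset.univ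
        (fun v w => if (v, w) ∈ S then x v * x w else 0), Finset.univ_product_univ]
      rw [← Finset.sum_filter (fun s : V × V => s ∈ S) (fun s => x s.1 * x s.2)]
      simp
  calc ∑ v, ∑ w, G.adjWeight v w * (x v * x w) ≤ ∑ v, ∑ w, (I v w + I w v) :=
        Finset.sum_le_sum fun v _ => Finset.sum_le_sum fun w _ => hle v w
    _ = ∑ v, ∑ w, I v w + ∑ v, ∑ w, I w v := by simp only [Finset.sum_add_distrib]
    _ = _ := by
      rw [Finset.sum_comm (f := fun v w => I w v), hsumI]
      ring

/-- A subinvariant vector normalized at its maximum `u`, for the eigenvalue `l` of `pendantK4`. -/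
structure IsSubinvariantAt [Fintype V] (G : SimpleGraph V) (l : ℝ) (x : V → ℝ) (u : V) : Prop where
  two_lt : 2 < l
  root : l ^ 2 * (l - 2) = (Fintype.card V - 1) * (l - 2) + 6
  nonneg : ∀ v, 0 ≤ x v
  le_one : ∀ v, x v ≤ 1
  eq_one : x u = 1
  le_sum : ∀ v, l * x v ≤ ∑ w, G.adjWeight v w * x w

namespace IsSubinvariantAt

variable [Fintype V] {l : ℝ} {x : V → ℝ} {u a b c : V}

/-- If the quadratic form of `G` is dominated by that of `pendantK4`, then there is no slack, and
`x` is the Perron vector of `pendantK4`. -/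
theorem eq_vector [DecidableEq V] (h : IsSubinvariantAt G l x u) (hd : Distinct4 u a b c) {t : ℝ} (ht : 0 ≤ t)
    (hQ : ∑ v, ∑ w, G.adjWeight v w * (x v * x w) + t ≤
      2 * (∑ v ∈ Finset.univ.erase u, x v + x a * x b + x b * x c + x a * x c)) :
    x = pendantK4Vector u a b c l ∧ t = 0 ∧ ∑ v, ∑ w, G.adjWeight v w * (x v * x w) =
      2 * (∑ v ∈ Finset.univ.erase u, x v + x a * x b + x b * x c + x a * x c) := by
  have h1 := pendantK4_rayleigh hd h.two_lt h.root h.eq_one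
  have h2 : x u * (∑ v, x v - x u) = ∑ v ∈ Finset.univ.erase u, x v := by
    rw [← Finset.add_sum_erase _ x (Finset.mem_univ u), h.eq_one]
    ring
  rw [h2] at h1
  -- With the Rayleigh bound this closes a loop of inequalities from l‖x‖² to itself, so the slack
  -- `t` must vanish.
  have h3 : l * ∑ v, x v ^ 2 ≤ ∑ v, ∑ w, G.adjWeight v w * (x v * x w) := by
    rw [Finset.mul_sum]
    refine Finset.sum_le_sum fun v _ => ?_
    calc l * x v ^ 2 = x v * (l * x v) := by ring
      _ ≤ x v * ∑ w, G.adjWeight v w * x w := mul_le_mul_of_nonneg_left (h.le_sum v) (h.nonneg v)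
      _ = _ := by
        rw [Finset.mul_sum]
        exact Finset.sum_congr rfl fun w _ => by ring
  exact ⟨h1.2 (by linarith), by linarith, by linarith⟩

/-- The Perron vector is positive, so one missing edge would make the form strictly smaller. -/
theorem eq_pendantK4 [DecidableEq V] (h : IsSubinvariantAt G l x u) (hd : Distinct4 u a b c)
    (hx : x = pendantK4Vector u a b c l)
    (hQ : ∑ v, ∑ w, G.adjWeight v w * (x v * x w) =
      2 * (∑ v ∈ Finset.univ.erase u, x v + x a * x b + x b * x c + x a * x c))
    (hle : G ≤ pendantK4 u a b c) : G = pendantK4 u a b c := by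
  refine le_antisymm hle fun v w hvw => ?_
  by_contra hG
  have h2 : x u * (∑ v, x v - x u) = ∑ v ∈ Finset.univ.erase u, x v := by
    rw [← Finset.add_sum_erase _ x (Finset.mem_univ u), h.eq_one]
    ring
  rw [← h2, ← sum_adjWeight_pendantK4_mul hd] at hQ
  have hpos : ∀ v, 0 < x v := fun v => hx ▸ pendantK4Vector_pos h.two_lt v
  have hterm : ∀ v w, G.adjWeight v w * (x v * x w) ≤
      (pendantK4 u a b c).adjWeight v w * (x v * x w) := by
    intro v w
    refine mul_le_mul_of_nonneg_right ?_ (mul_pos (hpos v) (hpos w)).le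
    by_cases h' : G.Adj v w
    · rw [adjWeight_of_adj h', adjWeight_of_adj (hle h')]
    · rw [adjWeight_of_not_adj h']; exact adjWeight_nonneg _ _ _
  refine hQ.not_lt (Finset.sum_lt_sum (fun v _ => Finset.sum_le_sum fun w _ => hterm v w)
    ⟨v, Finset.mem_univ _, Finset.sum_lt_sum (fun w _ => hterm v w) ⟨w, Finset.mem_univ _, ?_⟩⟩)
  rw [adjWeight_of_not_adj hG, adjWeight_of_adj hvw, zero_mul, one_mul]
  exact mul_pos (hpos v) (hpos w)

theorem pos_of_eq_vector (h : IsSubinvariantAt G l x u)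
    (hx : x = pendantK4Vector u a b c l) (v : V) : 0 < x v :=
  hx ▸ pendantK4Vector_pos h.two_lt v

/-- For 2 < l ≤ 3 and n ≥ 5, (l² - (n-1))(l-2) is at most 5, not 6. The bound gives 1/(l-2) < 1, so
that `u` is the only maximum of the Perron vector. -/
theorem three_lt (h : IsSubinvariantAt G l x u) (hcard : 5 ≤ Fintype.card V) : 3 < l := by
  have h1 := h.root
  have h2 := h.two_lt
  have h3 : (5 : ℝ) ≤ Fintype.card V := by exact_mod_cast hcard
  by_contra hl
  push Not at hl
  nlinarith [mul_nonneg (by linarith : (0:ℝ) ≤ l - 2) (by linarith : (0:ℝ) ≤ 3 - l),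
    mul_nonneg (by linarith : (0:ℝ) ≤ l - 2) (by linarith : (0:ℝ) ≤ Fintype.card V - 5)]

theorem vector_lt_one (h : IsSubinvariantAt G l x u) (hcard : 5 ≤ Fintype.card V)
    (hx : x = pendantK4Vector u a b c l) {v : V} (hv : v ≠ u) : x v < 1 := by
  have h3 := h.three_lt hcard
  rw [hx, pendantK4Vector, if_neg hv]
  split_ifs
  · rw [div_lt_one (by linarith)]; linarith
  · rw [div_lt_one (by linarith)]; linarith

end IsSubinvariantAt

end SimpleGraph

/-! ### Graphs containing a triangle -/

namespace SimpleGraph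

variable {V : Type*} {G : SimpleGraph V}

namespace IsSubinvariantAt

variable [Fintype V] [DecidableEq V] {l : ℝ} {x : V → ℝ} {u : V}

/-- If some triangle avoids the vertex `u`, then `G` is `pendantK4` on that triangle. -/
theorem eq_pendantK4_of_triangle_avoiding (h : IsSubinvariantAt G l x u)
    (hcard : 5 ≤ Fintype.card V) (hG : ¬ HasTwoEdgeDisjointCycles G) {p q r : V}
    (hpq : G.Adj p q) (hqr : G.Adj q r) (hrp : G.Adj r p) (hup : u ≠ p) (huq : u ≠ q)
    (hur : u ≠ r) : ∃ a b c, Distinct4 u a b c ∧ G = pendantK4 u a b c := by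
  have hd : Distinct4 u p q r := ⟨hup, huq, hur, hpq.ne, hrp.ne', hqr.ne⟩
  obtain ⟨C, hC, hE⟩ := exists_isCycle_of_triangle hpq hqr hrp
  obtain ⟨par, hcov, -, -⟩ := exists_parent_of_isCycle hG hC u
  let S : Finset (V × V) := {(p, q), (q, r), (p, r)}
  have hcover : ∀ v w, G.Adj v w →
      (v ≠ u ∧ par v = w ∨ w ≠ u ∧ par w = v) ∨ (v, w) ∈ S ∨ (w, v) ∈ S := by
    intro v w hvw
    rcases hcov v w hvw with h1 | h1
    · exact .inl h1
    · rw [hE] at h1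
      simp only [List.mem_cons, Sym2.eq_iff, List.not_mem_nil, or_false] at h1
      simp only [S, Finset.mem_insert, Finset.mem_singleton, Prod.mk.injEq]
      tauto
  have hQ := sum_adjWeight_mul_le_of_cover hcover h.nonneg
  have hS : ∑ s ∈ S, x s.1 * x s.2 = x p * x q + x q * x r + x p * x r := by
    have := hpq.ne
    have := hqr.ne
    have := hrp.ne
    simp only [S]
    rw [Finset.sum_insert (by simp [*]), Finset.sum_insert (by simp [*, eq_comm]),
      Finset.sum_singleton]
    ring
  have hslack : ∀ v, 0 ≤ x v * (1 - x (par v)) := fun v =>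
    mul_nonneg (h.nonneg v) (sub_nonneg.mpr (h.le_one _))
  obtain ⟨hx, ht, hQ'⟩ := h.eq_vector hd
    (t := 2 * ∑ v ∈ Finset.univ.erase u, x v * (1 - x (par v)))
    (mul_nonneg zero_le_two (Finset.sum_nonneg fun v _ => hslack v)) (by
      simp only [mul_sub, mul_one, Finset.sum_sub_distrib]
      linarith)
  -- Zero slack at v means x(par v) = 1, and only `u` has value 1.
  have hpar : ∀ v, v ≠ u → par v = u := by
    intro v hv
    by_contra hne
    have h1 := (Finset.sum_eq_zero_iff_of_nonneg fun v _ => hslack v).mp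
      ((mul_eq_zero.mp ht).resolve_left two_ne_zero) v (by simp [hv])
    have h2 := h.vector_lt_one hcard hx hne
    have h3 : 0 < x v := hx ▸ pendantK4Vector_pos h.two_lt v
    exact (mul_pos h3 (sub_pos.mpr h2)).ne' h1
  refine ⟨p, q, r, hd, h.eq_pendantK4 hd hx hQ' fun v w hvw => ?_⟩
  rw [pendantK4_adj]
  refine ⟨hvw.ne, ?_⟩
  rcases hcover v w hvw with (⟨h1, h2⟩ | ⟨h1, h2⟩) | h1
  · exact .inr (.inl (h2 ▸ hpar v h1))
  · exact .inl (h2 ▸ hpar w h1)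
  · simp only [S, Finset.mem_insert, Finset.mem_singleton, Prod.mk.injEq] at h1
    tauto

/-- A strictly dominated quadratic form is impossible. -/
theorem not_strictly_dominated {a b c v w : V} {t : ℝ} (h : IsSubinvariantAt G l x u)
    (hd : Distinct4 u a b c) (ht : 0 ≤ t)
    (hQ : ∑ v, ∑ w, G.adjWeight v w * (x v * x w) + (x v * x w + t) ≤
      2 * (∑ v ∈ Finset.univ.erase u, x v + x a * x b + x b * x c + x a * x c)) : False := by
  have h0 := mul_nonneg (h.nonneg v) (h.nonneg w)
  obtain ⟨hx, h1, -⟩ := h.eq_vector hd (add_nonneg h0 ht) hQ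
  have := mul_pos (h.pos_of_eq_vector hx v) (h.pos_of_eq_vector hx w)
  linarith

/-- For a further vertex z, the form of `pendantK4 u p q z` has in addition the terms of pz and qz,
positive in the equality case. -/
theorem not_dominated_by_single_edge {p q : V} (h : IsSubinvariantAt G l x u)
    (hcard : 5 ≤ Fintype.card V) (hpu : p ≠ u) (hqu : q ≠ u) (hpq : p ≠ q)
    (hQ : ∑ v, ∑ w, G.adjWeight v w * (x v * x w) ≤
      2 * (∑ v ∈ Finset.univ.erase u, x v + x p * x q)) : False := by
  obtain ⟨z, hz⟩ : ∃ z, z ∉ ({u, p, q} : Finset V) := by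
    by_contra! hall
    have h1 : Fintype.card V ≤ ({u, p, q} : Finset V).card :=
      Finset.card_le_card fun v _ => hall v
    have h2 : ({u, p, q} : Finset V).card ≤ 3 := Finset.card_le_three
    omega
  simp only [Finset.mem_insert, Finset.mem_singleton, not_or] at hz
  refine h.not_strictly_dominated (v := p) (w := z) (t := 0)
    (show Distinct4 u p q z from
      ⟨hpu.symm, hqu.symm, Ne.symm hz.1, hpq, Ne.symm hz.2.1, Ne.symm hz.2.2⟩) le_rfl ?_
  linarith [mul_nonneg (h.nonneg p) (h.nonneg z), mul_nonneg (h.nonneg q) (h.nonneg z)]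

end IsSubinvariantAt

/-- The edges of `G` outside the triangle `u p q` join vertices to their parents in a tree rooted
at `u`. -/
structure IsTriangleParent (G : SimpleGraph V) (u p q : V) (par : V → V) : Prop where
  cover : ∀ v w, G.Adj v w → (v ≠ u ∧ par v = w ∨ w ≠ u ∧ par w = v) ∨
    s(v, w) = s(p, u) ∨ s(v, w) = s(q, u) ∨ s(v, w) = s(p, q)
  par_ne : ∀ v, v ≠ u → par v ≠ v
  par_par_ne : ∀ v, v ≠ u → par v ≠ u → par (par v) ≠ v
  left_ne : p ≠ u
  right_ne : q ≠ u
  left_ne_right : p ≠ q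

namespace IsTriangleParent

variable {l : ℝ} {x : V → ℝ} {u p q : V} {par : V → V}

theorem symm (hT : IsTriangleParent G u p q par) : IsTriangleParent G u q p par := by
  refine ⟨fun v w hvw => ?_, hT.par_ne, hT.par_par_ne, hT.right_ne, hT.left_ne,
    hT.left_ne_right.symm⟩
  have := hT.cover v w hvw
  rw [Sym2.eq_swap (a := q) (b := p)]
  tauto

variable [Fintype V]

theorem slack_nonneg (h : IsSubinvariantAt G l x u) (v : V) : 0 ≤ x v * (1 - x (par v)) :=
  mul_nonneg (h.nonneg v) (sub_nonneg.mpr (h.le_one _))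

theorem sum_slack_nonneg (h : IsSubinvariantAt G l x u) (R : Finset V) :
    0 ≤ ∑ v ∈ R, x v * (1 - x (par v)) :=
  Finset.sum_nonneg fun v _ => slack_nonneg h v

variable [DecidableEq V]

/-- `S` needs to list only the triangle edges that are not tree edges, which avoids double counting.
The terms at p and q are kept apart because their parents decide the case. -/
theorem quadratic_le (hT : IsTriangleParent G u p q par) (h : IsSubinvariantAt G l x u)
    (S : Finset (V × V))
    (hS : ∀ v w, s(v, w) = s(p, u) ∨ s(v, w) = s(q, u) ∨ s(v, w) = s(p, q) →
      (v ≠ u ∧ par v = w ∨ w ≠ u ∧ par w = v) ∨ (v, w) ∈ S ∨ (w, v) ∈ S) :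
    ∑ v, ∑ w, G.adjWeight v w * (x v * x w) +
        2 * ∑ v ∈ ((Finset.univ.erase u).erase p).erase q, x v * (1 - x (par v)) ≤
      2 * (∑ v ∈ Finset.univ.erase u, x v - x p - x q + x p * x (par p) + x q * x (par q) +
        ∑ s ∈ S, x s.1 * x s.2) := by
  have hsplit : ∀ f : V → ℝ, ∑ v ∈ Finset.univ.erase u, f v =
      f p + f q + ∑ v ∈ ((Finset.univ.erase u).erase p).erase q, f v := by
    intro f
    rw [← Finset.add_sum_erase _ f (show p ∈ Finset.univ.erase u by simp [hT.left_ne]),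
      ← Finset.add_sum_erase _ f (show q ∈ (Finset.univ.erase u).erase p by
        simp [hT.right_ne, hT.left_ne_right.symm]), add_assoc]
  have h1 := sum_adjWeight_mul_le_of_cover (S := S) (u := u) (par := par)
    (fun v w hvw => (hT.cover v w hvw).elim .inl (hS v w)) h.nonneg
  rw [hsplit] at h1
  rw [hsplit x]
  simp only [mul_sub, mul_one, Finset.sum_sub_distrib]
  linarith

theorem false_of_both_root (hT : IsTriangleParent G u p q par) (h : IsSubinvariantAt G l x u)
    (hcard : 5 ≤ Fintype.card V) (hp : par p = u) (hq : par q = u) : False := by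
  have hpu := hT.left_ne
  have hqu := hT.right_ne
  have hQ := hT.quadratic_le h {(p, q)} (by
    intro v w hvw
    simp only [Finset.mem_singleton, Prod.mk.injEq, Sym2.eq_iff] at hvw ⊢
    grind)
  rw [Finset.sum_singleton, hp, hq, h.eq_one] at hQ
  refine h.not_dominated_by_single_edge hcard hT.left_ne hT.right_ne hT.left_ne_right ?_
  linarith [sum_slack_nonneg (par := par) h (((Finset.univ.erase u).erase p).erase q)]

/-- Beyond the star there remains either the edge pq alone or the path q – p – `par p`, which lacks
one edge of a triangle. -/
theorem false_of_right_root (hT : IsTriangleParent G u p q par) (h : IsSubinvariantAt G l x u)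
    (hcard : 5 ≤ Fintype.card V) (hp : par p ≠ u) (hq : par q = u) : False := by
  have hpu := hT.left_ne
  have hqu := hT.right_ne
  have hpq := hT.left_ne_right
  have hsl := sum_slack_nonneg (par := par) h (((Finset.univ.erase u).erase p).erase q)
  by_cases hpq' : par p = q
  · have hQ := hT.quadratic_le h {(p, u)} (by
      intro v w hvw
      simp only [Finset.mem_singleton, Prod.mk.injEq, Sym2.eq_iff] at hvw ⊢
      grind)
    rw [Finset.sum_singleton, hpq', hq, h.eq_one] at hQ
    refine h.not_dominated_by_single_edge hcard hpu hqu hpq ?_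
    linarith
  · have hQ := hT.quadratic_le h {(p, u), (p, q)} (by
      intro v w hvw
      simp only [Finset.mem_insert, Finset.mem_singleton, Prod.mk.injEq, Sym2.eq_iff] at hvw ⊢
      grind)
    rw [Finset.sum_pair (by simp [hqu.symm]), hq, h.eq_one] at hQ
    refine h.not_strictly_dominated (v := q) (w := par p) (t := 0)
      (show Distinct4 u p q (par p) from
        ⟨hpu.symm, hqu.symm, Ne.symm hp, hpq, (hT.par_ne p hpu).symm, Ne.symm hpq'⟩) le_rfl ?_
    dsimp only at hQ
    linarith [mul_nonneg (h.nonneg q) (h.nonneg (par p))]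

/-- Here the path p – q – `par q` remains, lacking the edge from p to `par q`. -/
theorem false_of_par_left_eq (hT : IsTriangleParent G u p q par) (h : IsSubinvariantAt G l x u)
    (hp : par p = q) (hq : par q ≠ u) : False := by
  have hpu := hT.left_ne
  have hqu := hT.right_ne
  have hpq := hT.left_ne_right
  have hqp : par q ≠ p := hp ▸ hT.par_par_ne p hpu (hp ▸ hqu)
  have hsl := sum_slack_nonneg (par := par) h (((Finset.univ.erase u).erase p).erase q)
  have hQ := hT.quadratic_le h {(p, u), (q, u)} (by
    intro v w hvw
    simp only [Finset.mem_insert, Finset.mem_singleton, Prod.mk.injEq, Sym2.eq_iff] at hvw ⊢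
    grind)
  rw [Finset.sum_pair (by simp [hpq]), hp, h.eq_one] at hQ
  refine h.not_strictly_dominated (v := p) (w := par q) (t := 0)
    (show Distinct4 u p q (par q) from
      ⟨hpu.symm, hqu.symm, Ne.symm hq, hpq, hqp.symm, (hT.par_ne q hqu).symm⟩) le_rfl ?_
  dsimp only at hQ
  linarith [mul_nonneg (h.nonneg p) (h.nonneg (par q))]

/-- Beyond the star there remain pq and the edges from p and q to their parents. Redirecting q to
the heavier parent `par p` completes a triangle, and the loss counts as slack. -/
theorem eq_pendantK4_of_le (hT : IsTriangleParent G u p q par) (h : IsSubinvariantAt G l x u)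
    (hcard : 5 ≤ Fintype.card V) (hp : par p ≠ u) (hpq' : par p ≠ q)
    (hqp' : par q ≠ p) (hle : x (par q) ≤ x (par p)) :
    ∃ a b c, Distinct4 u a b c ∧ G = pendantK4 u a b c := by
  have hpu := hT.left_ne
  have hqu := hT.right_ne
  have hpq := hT.left_ne_right
  have hd : Distinct4 u p q (par p) :=
    ⟨hpu.symm, hqu.symm, Ne.symm hp, hpq, (hT.par_ne p hpu).symm, Ne.symm hpq'⟩
  have hsl := sum_slack_nonneg (par := par) h (((Finset.univ.erase u).erase p).erase q)
  have hQ := hT.quadratic_le h {(p, u), (q, u), (p, q)} (by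
    intro v w hvw
    simp only [Finset.mem_insert, Finset.mem_singleton, Prod.mk.injEq, Sym2.eq_iff] at hvw ⊢
    grind)
  rw [Finset.sum_insert (by simp [hpq, hqu.symm]), Finset.sum_pair (by simp [hpq.symm]),
    h.eq_one] at hQ
  have hslq : 0 ≤ x q * (x (par p) - x (par q)) := mul_nonneg (h.nonneg q) (sub_nonneg.mpr hle)
  obtain ⟨hx, ht, hQ'⟩ := h.eq_vector hd
    (t := 2 * ∑ v ∈ ((Finset.univ.erase u).erase p).erase q, x v * (1 - x (par v)) +
      2 * (x q * (x (par p) - x (par q)))) (by linarith) (by linarith)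
  have hpos := h.pos_of_eq_vector hx
  have hroot : ∀ v, v ≠ u → v ≠ p → v ≠ q → par v = u := by
    intro v hvu hvp hvq
    by_contra hne
    have h1 := (Finset.sum_eq_zero_iff_of_nonneg fun v _ => slack_nonneg h v).mp
      (show ∑ v ∈ ((Finset.univ.erase u).erase p).erase q, x v * (1 - x (par v)) = 0 by linarith)
      v (by simp [hvu, hvp, hvq])
    have h2 := h.vector_lt_one hcard hx hne
    exact (mul_pos (hpos v) (sub_pos.mpr h2)).ne' h1
  have heq : x (par q) = x (par p) := by
    have h1 : x q * (x (par p) - x (par q)) = 0 := by linarith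
    linarith [(mul_eq_zero.mp h1).resolve_left (hpos q).ne']
  -- Any other vertex would carry the smaller value 1/l.
  have hpar : par q = u ∨ par q = par p := by
    by_contra! hne
    have h1 : x (par p) = 1 / (l - 2) := by
      rw [hx, pendantK4Vector, if_neg hp, if_pos (by simp)]
    have h2 : x (par q) = 1 / l := by
      rw [hx, pendantK4Vector, if_neg hne.1, if_neg (by simp [hqp', hT.par_ne q hqu, hne.2])]
    have h3 := h.two_lt
    have h4 : 1 / l < 1 / (l - 2) := one_div_lt_one_div_of_lt (by linarith) (by linarith)
    linarith
  refine ⟨p, q, par p, hd, h.eq_pendantK4 hd hx hQ' fun v w hvw => ?_⟩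
  rw [pendantK4_adj]
  refine ⟨hvw.ne, ?_⟩
  have := hT.cover v w hvw
  simp only [Sym2.eq_iff] at this
  have hedge : ∀ v w, v ≠ u → par v = w → v = u ∨ w = u ∨
      (v = p ∨ v = q ∨ v = par p) ∧ (w = p ∨ w = q ∨ w = par p) := by
    rintro v w hv rfl
    by_cases hvp : v = p
    · exact .inr (.inr ⟨.inl hvp, .inr (.inr (hvp ▸ rfl))⟩)
    by_cases hvq : v = q
    · rw [hvq]
      exact hpar.elim (fun h1 => .inr (.inl h1)) fun h1 =>
        .inr (.inr ⟨.inr (.inl rfl), .inr (.inr h1)⟩)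
    · exact .inr (.inl (hroot v hv hvp hvq))
  rcases this with (⟨h1, h2⟩ | ⟨h1, h2⟩) | h1
  · exact hedge v w h1 h2
  · have := hedge w v h1 h2
    tauto
  · tauto

end IsTriangleParent

/-- If some triangle contains the vertex `u`, then `G` is a graph `pendantK4`. -/
theorem IsSubinvariantAt.eq_pendantK4_of_triangle_through [Fintype V] {l : ℝ} {x : V → ℝ} {u : V}
    (h : IsSubinvariantAt G l x u) (hcard : 5 ≤ Fintype.card V)
    (hG : ¬ HasTwoEdgeDisjointCycles G) {p q : V}
    (hup : G.Adj u p) (hpq : G.Adj p q) (hqu : G.Adj q u) :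
    ∃ a b c, Distinct4 u a b c ∧ G = pendantK4 u a b c := by
  classical
  obtain ⟨C, hC, hE⟩ := exists_isCycle_of_triangle hup hpq hqu
  obtain ⟨par, hcov, hne, hinv⟩ := exists_parent_of_isCycle hG hC u
  have hT : IsTriangleParent G u p q par := by
    refine ⟨fun v w hvw => (hcov v w hvw).imp_right fun h1 => ?_, hne, hinv, hup.ne', hqu.ne,
      hpq.ne⟩
    rw [hE] at h1
    simp only [List.mem_cons, List.not_mem_nil, or_false] at h1
    rw [Sym2.eq_swap (a := p) (b := u)]
    tauto
  by_cases hp : par p = u <;> by_cases hq : par q = u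
  · exact (hT.false_of_both_root h hcard hp hq).elim
  · exact (hT.symm.false_of_right_root h hcard hq hp).elim
  · exact (hT.false_of_right_root h hcard hp hq).elim
  · by_cases hpq' : par p = q
    · exact (hT.false_of_par_left_eq h hpq' hq).elim
    by_cases hqp' : par q = p
    · exact (hT.symm.false_of_par_left_eq h hqp' hp).elim
    rcases le_total (x (par q)) (x (par p)) with hle | hle
    · exact hT.eq_pendantK4_of_le h hcard hp hpq' hqp' hle
    · exact hT.symm.eq_pendantK4_of_le h hcard hq hqp' hpq' hle

end SimpleGraph

/-! ### Numerical estimates for triangle-free graphs -/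

namespace SimpleGraph

variable {V : Type*} {G : SimpleGraph V}

/-- The numerical contradiction behind the triangle-free case. -/
theorem false_of_trianglefree_bounds {l N d j e r X : ℝ} (hl : 4.3 ≤ l) (hd : d * (l - 2) = 6)
    (hN : N ≤ 4 ∨ 5 ≤ N) (hN0 : N = 0 ∨ 1 ≤ N) (hj : 0 ≤ j) (hej : e + j ≤ N + 4)
    (hr : N + d ≤ r) (hrX : r ≤ 3 * X) (hre : r ≤ e) (hX : 0 ≤ X) (hXN : X ≤ N)
    (h1 : l * X ≤ e + 2 * j) (h2 : l ^ 2 * X ≤ e * (1 + X) + l * (j * X)) : False := by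
  -- In the application `N` counts the non-neighbours of `u` and `X` is their total weight; `e`
  -- counts their edges to neighbours of `u`, `j` the edges among them, and `r` is the codegree sum
  -- weighted by `x`.
  obtain ⟨s, rfl⟩ : ∃ s, l = s + 2 := ⟨l - 2, by ring⟩
  have hs : 2.3 ≤ s := by linarith
  rw [add_sub_cancel_right] at hd
  have hd0 : 0 < d := by
    by_contra h
    nlinarith
  have hjd : j ≤ 4 - d := by linarith
  have hN1 : 1 ≤ N := hN0.resolve_left fun h => by linarith
  have hXd : N + d ≤ 3 * X := by linarith
  -- For N ≤ 4 the second-order bound `h2` is used. For N ≥ 5, `h1` yields 5s + 5d ≤ 23, and ds = 6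
  -- turns this into 5s² - 23s + 30 ≤ 0, whose discriminant is negative.
  rcases hN with hN | hN
  · have h3 : ((s + 2) ^ 2 - (s + 1) * j - N - 4) * X ≤ N + 4 := by nlinarith
    have h4 : s ^ 2 + 2 + d - N ≤ (s + 2) ^ 2 - (s + 1) * j - N - 4 := by
      nlinarith [mul_le_mul_of_nonneg_left hjd (by linarith : (0 : ℝ) ≤ s + 1)]
    have h5 : (s ^ 2 + 2 + d - N) * X ≤ N + 4 := (mul_le_mul_of_nonneg_right h4 hX).trans h3
    have hK : 0 ≤ s ^ 2 + 2 + d - N := by nlinarith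
    have h6 : (s ^ 2 + 2 + d - N) * (N + d) ≤ 3 * (N + 4) := by
      have := mul_le_mul_of_nonneg_left hXd hK
      linarith
    have h7 : 5.29 ≤ s ^ 2 := by nlinarith
    have h8 : d * s ^ 2 = 6 * s := by rw [pow_two, ← mul_assoc, hd]
    nlinarith [mul_nonneg (by linarith : (0:ℝ) ≤ N - 1) (by linarith : (0:ℝ) ≤ 4 - N),
      mul_nonneg (by linarith : (0:ℝ) ≤ N - 1) (by linarith : (0:ℝ) ≤ s ^ 2 - 5.29),
      mul_pos hd0 hd0]
  · have h3 : (s + 2) * (N + d) ≤ (s + 2) * (3 * X) :=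
      mul_le_mul_of_nonneg_left hXd (by linarith)
    have h4 : (s + 2) * (N + d) = s * N + 2 * N + 6 + 2 * d := by linear_combination hd
    have h5 : (s - 1) * 5 ≤ (s - 1) * N := mul_le_mul_of_nonneg_left hN (by linarith)
    have h6 : s * (5 * s + 5 * d) ≤ s * 23 := mul_le_mul_of_nonneg_left (by linarith) (by linarith)
    nlinarith [sq_nonneg (s - 2.3)]

end SimpleGraph

/-! ### Triangle-free graphs -/

namespace SimpleGraph

variable {V : Type*} {G : SimpleGraph V} [Fintype V]

open Classical in
/-- The set of non-neighbours of `u` other than `u`. -/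
noncomputable def farVertices (G : SimpleGraph V) (u : V) : Finset V :=
  Finset.univ.filter fun v => v ≠ u ∧ ¬ G.Adj u v

open Classical in
/-- The set of neighbours of `u`. -/
noncomputable def nearVertices (G : SimpleGraph V) (u : V) : Finset V :=
  Finset.univ.filter fun v => G.Adj u v

theorem mem_farVertices {u v : V} : v ∈ G.farVertices u ↔ v ≠ u ∧ ¬ G.Adj u v := by
  simp [farVertices]

theorem mem_nearVertices {u v : V} : v ∈ G.nearVertices u ↔ G.Adj u v := by
  simp [nearVertices]

theorem sum_eq_near_add_far (G : SimpleGraph V) (u : V) (f : V → ℝ) :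
    ∑ v, f v = f u + ∑ v ∈ G.nearVertices u, f v + ∑ v ∈ G.farVertices u, f v := by
  classical
  have h1 : ∀ v, f v = (if v = u then f v else 0) + (if G.Adj u v then f v else 0) +
      (if v ≠ u ∧ ¬ G.Adj u v then f v else 0) := by
    intro v
    by_cases hv : v = u
    · subst hv; simp
    · by_cases hv' : G.Adj u v <;> simp [hv, hv']
  rw [Finset.sum_congr rfl fun v _ => h1 v, Finset.sum_add_distrib, Finset.sum_add_distrib,
    Finset.sum_ite_eq' _ u, ← Finset.sum_filter, ← Finset.sum_filter]
  simp [nearVertices, farVertices]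

theorem card_eq_near_add_far (G : SimpleGraph V) (u : V) :
    (Fintype.card V : ℝ) = 1 + (G.nearVertices u).card + (G.farVertices u).card := by
  simpa using G.sum_eq_near_add_far u fun _ => 1

theorem sum_adjWeight_root_near (G : SimpleGraph V) (u : V) (f : V → ℝ) :
    ∑ w, G.adjWeight u w * f w = ∑ w ∈ G.nearVertices u, f w := by
  rw [G.sum_eq_near_add_far u, adjWeight_of_not_adj (G.irrefl), zero_mul, zero_add,
    Finset.sum_eq_zero (s := G.farVertices u), add_zero]
  · exact Finset.sum_congr rfl fun w hw => by
      rw [adjWeight_of_adj (mem_nearVertices.mp hw), one_mul]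
  · intro w hw
    rw [adjWeight_of_not_adj (mem_farVertices.mp hw).2, zero_mul]

theorem sum_adjWeight_far (G : SimpleGraph V) {u w : V} (hw : w ∈ G.farVertices u) (f : V → ℝ) :
    ∑ v, G.adjWeight w v * f v = ∑ v ∈ G.nearVertices u, G.adjWeight w v * f v +
      ∑ z ∈ G.farVertices u, G.adjWeight w z * f z := by
  rw [G.sum_eq_near_add_far u, adjWeight_of_not_adj fun h => (mem_farVertices.mp hw).2 h.symm,
    zero_mul, zero_add]

theorem sum_adjWeight_near (htri : ∀ a b c, G.Adj a b → G.Adj b c → ¬ G.Adj c a) {u v : V}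
    (hv : v ∈ G.nearVertices u) (f : V → ℝ) :
    ∑ w, G.adjWeight v w * f w = f u + ∑ w ∈ G.farVertices u, G.adjWeight v w * f w := by
  rw [G.sum_eq_near_add_far u, adjWeight_of_adj (mem_nearVertices.mp hv).symm, one_mul,
    Finset.sum_eq_zero (s := G.nearVertices u), add_zero]
  intro w hw
  rw [adjWeight_of_not_adj, zero_mul]
  exact fun h => htri u v w (mem_nearVertices.mp hv) h (mem_nearVertices.mp hw).symm

/-- The number of neighbours of `w` among the neighbours of `u`. -/
noncomputable def codegree (G : SimpleGraph V) (u w : V) : ℝ :=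
  ∑ v ∈ G.nearVertices u, G.adjWeight w v

open Classical in
theorem codegree_eq_card (G : SimpleGraph V) (u w : V) :
    G.codegree u w = ((G.nearVertices u).filter fun v => G.Adj w v).card := by
  simp [codegree, adjWeight]

/-- Without two edge-disjoint cycles, two vertices have at most three common neighbours. -/
theorem codegree_le_three (hG : ¬ HasTwoEdgeDisjointCycles G) {u w : V} (huw : u ≠ w) :
    G.codegree u w ≤ 3 := by
  classical
  rw [codegree_eq_card]
  by_contra! hlt
  have hlt' : 3 < ((G.nearVertices u).filter fun v => G.Adj w v).card := by exact_mod_cast hlt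
  have hmem : ∀ v ∈ (G.nearVertices u).filter fun v => G.Adj w v, G.Adj u v ∧ G.Adj w v :=
    fun v hv => by
      rw [Finset.mem_filter, mem_nearVertices] at hv
      exact hv
  obtain ⟨T, hTsub, hT⟩ := Finset.exists_subset_card_eq (show 4 ≤ _ from hlt')
  obtain ⟨a, T', haT, rfl, hT'⟩ := Finset.card_eq_succ.mp hT
  obtain ⟨b, c, d, hbc, hbd, hcd, rfl⟩ := Finset.card_eq_three.mp hT'
  simp only [Finset.mem_insert, Finset.mem_singleton, not_or] at haT
  have ha := hmem a (hTsub (by simp))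
  have hb := hmem b (hTsub (by simp))
  have hc := hmem c (hTsub (by simp))
  have hd := hmem d (hTsub (by simp))
  -- Four common neighbours split into two pairs, each closing a four-cycle through `u` and `w`.
  obtain ⟨C, hC, hCE⟩ := exists_isCycle_of_square ha.1 ha.2.symm hb.2 hb.1.symm huw haT.1
  obtain ⟨D, hD, hDE⟩ := exists_isCycle_of_square hc.1 hc.2.symm hd.2 hd.1.symm huw hcd
  refine hG ⟨u, u, C, D, hC, hD, ?_⟩
  have := ha.1.ne
  have := ha.2.ne
  have := hb.1.ne
  have := hb.2.ne
  have := hc.1.ne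
  have := hc.2.ne
  have := hd.1.ne
  have := hd.2.ne
  intro e he he'
  rw [hCE] at he
  rw [hDE] at he'
  simp only [List.mem_cons, List.not_mem_nil, or_false] at he he'
  rcases he with rfl | rfl | rfl | rfl <;>
    (simp only [Sym2.eq_iff] at he'; grind)

/-- Counting edges outside a four-cycle: the degree sum of a graph without two edge-disjoint
cycles which contains a four-cycle is at most `2 (n + 3)`. -/
theorem sum_adjWeight_le_of_square (hG : ¬ HasTwoEdgeDisjointCycles G) {u a w b : V}
    (hua : G.Adj u a) (haw : G.Adj a w) (hwb : G.Adj w b) (hbu : G.Adj b u) (huw : u ≠ w)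
    (hab : a ≠ b) : ∑ v, ∑ z, G.adjWeight v z ≤ 2 * (Fintype.card V + 3) := by
  classical
  obtain ⟨C, hC, hCE⟩ := exists_isCycle_of_square hua haw hwb hbu huw hab
  obtain ⟨par, hcov, -, -⟩ := exists_parent_of_isCycle hG hC u
  let S : Finset (V × V) := {(u, a), (a, w), (w, b), (b, u)}
  -- With x = 1 the form is the degree sum: n - 1 parent pairs and at most four cycle edges, each
  -- counted twice.
  have h1 := sum_adjWeight_mul_le_of_cover (S := S) (u := u) (par := par) (x := fun _ => 1)
    (fun v z hvz => (hcov v z hvz).imp_right fun h1 => by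
      rw [hCE] at h1
      simp only [List.mem_cons, Sym2.eq_iff, List.not_mem_nil, or_false] at h1
      simp only [S, Finset.mem_insert, Finset.mem_singleton, Prod.mk.injEq]
      tauto) fun _ => zero_le_one
  have h2 : (S.card : ℝ) ≤ 4 := by exact_mod_cast Finset.card_le_four
  have h3 : (1 : ℝ) ≤ Fintype.card V := by exact_mod_cast Fintype.card_pos_iff.mpr ⟨u⟩
  simp only [mul_one, Finset.sum_const, nsmul_eq_mul, Finset.mem_univ, Finset.card_erase_of_mem,
    Finset.card_univ, Nat.cast_pred (Fintype.card_pos_iff.mpr ⟨u⟩)] at h1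
  linarith

/-- A graph without triangles and without two edge-disjoint cycles has spectral radius less than
that of `pendantK4`. -/
theorem IsSubinvariantAt.false_of_trianglefree {l : ℝ} {x : V → ℝ} {u : V}
    (h : IsSubinvariantAt G l x u) (hl : 4.3 ≤ l) (hG : ¬ HasTwoEdgeDisjointCycles G)
    (htri : ∀ a b c, G.Adj a b → G.Adj b c → ¬ G.Adj c a) : False := by
  classical
  set N := G.nearVertices u with hNdef
  set W := G.farVertices u with hWdef
  have hl0 : 0 < l := by linarith
  have hl2 : 0 < l - 2 := by linarith
  let d : ℝ := 6 / (l - 2)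
  have hd : d * (l - 2) = 6 := div_mul_cancel₀ _ hl2.ne'
  have hd0 : 0 < d := div_pos (by norm_num) hl2
  have hcard := G.card_eq_near_add_far u
  have hroot : l ^ 2 = N.card + W.card + d := by
    have h1 : (l ^ 2 - (N.card + W.card + d)) * (l - 2) = 0 := by
      have := h.root
      rw [hcard] at this
      linear_combination this - hd
    linarith [(mul_eq_zero.mp h1).resolve_right hl2.ne']
  let c := G.codegree u
  let r := ∑ w ∈ W, c w * x w
  let X := ∑ w ∈ W, x w
  let e := ∑ w ∈ W, c w
  let j := (∑ w ∈ W, ∑ z ∈ W, G.adjWeight w z) / 2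
  have hc0 : ∀ w, 0 ≤ c w := fun w => Finset.sum_nonneg fun v _ => adjWeight_nonneg _ _ _
  have hne : ∀ w ∈ W, u ≠ w := fun w hw => (mem_farVertices.mp hw).1.symm
  have hswap : ∀ f : V → ℝ, ∑ v ∈ N, ∑ w ∈ W, G.adjWeight v w * f w = ∑ w ∈ W, c w * f w := by
    intro f
    rw [Finset.sum_comm]
    refine Finset.sum_congr rfl fun w _ => ?_
    rw [← Finset.sum_mul]
    exact congrArg (· * f w) (Finset.sum_congr rfl fun v _ => adjWeight_comm _ _ _)
  have hnear : ∀ v ∈ N, l * x v ≤ 1 + ∑ w ∈ W, G.adjWeight v w * x w := by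
    intro v hv
    have := h.le_sum v
    rwa [sum_adjWeight_near htri hv, h.eq_one] at this
  have hr : W.card + d ≤ r := by
    have h1 := h.le_sum u
    rw [sum_adjWeight_root_near, h.eq_one, mul_one] at h1
    have h2 : l ^ 2 ≤ N.card + r := by
      calc l ^ 2 = l * l := by ring
        _ ≤ l * ∑ v ∈ N, x v := mul_le_mul_of_nonneg_left h1 hl0.le
        _ = ∑ v ∈ N, l * x v := Finset.mul_sum _ _ _
        _ ≤ ∑ v ∈ N, (1 + ∑ w ∈ W, G.adjWeight v w * x w) := Finset.sum_le_sum hnear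
        _ = N.card + r := by rw [Finset.sum_add_distrib, hswap]; simp [r]
    linarith
  have hX0 : 0 ≤ X := Finset.sum_nonneg fun w _ => h.nonneg w
  have hXN : X ≤ W.card := by
    have := Finset.sum_le_sum fun w (_ : w ∈ W) => h.le_one w
    simpa using this
  have hrX : r ≤ 3 * X := by
    rw [Finset.mul_sum]
    exact Finset.sum_le_sum fun w hw =>
      mul_le_mul_of_nonneg_right (codegree_le_three hG (hne w hw)) (h.nonneg w)
  have hre : r ≤ e := Finset.sum_le_sum fun w _ => mul_le_of_le_one_right (hc0 w) (h.le_one w)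
  have hj0 : 0 ≤ j := div_nonneg
    (Finset.sum_nonneg fun w _ => Finset.sum_nonneg fun z _ => adjWeight_nonneg _ _ _) zero_le_two
  have hej : e + j ≤ W.card + 4 := by
    -- If all codegrees were at most 1, then r ≤ X ≤ |W|, against |W| + d ≤ r. Hence a four-cycle
    -- exists and the edge count applies.
    obtain ⟨w, hw, hcw⟩ : ∃ w ∈ W, 1 < c w := by
      by_contra! hall
      have : r ≤ X := Finset.sum_le_sum fun w hw => mul_le_of_le_one_left (h.nonneg w) (hall w hw)
      linarith
    rw [show c w = _ from codegree_eq_card G u w] at hcw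
    obtain ⟨a, b, ha, hb, hab⟩ := Finset.one_lt_card_iff.mp (by exact_mod_cast hcw)
    rw [Finset.mem_filter, mem_nearVertices] at ha hb
    have h1 := sum_adjWeight_le_of_square hG ha.1 ha.2.symm hb.2 hb.1.symm (hne w hw) hab
    have h2 : ∑ v, ∑ z, G.adjWeight v z = 2 * N.card + 2 * e + 2 * j := by
      have k1 : ∑ z, G.adjWeight u z = N.card := by
        have := sum_adjWeight_root_near G u fun _ => 1
        simpa using this
      have k2 : ∑ v ∈ N, ∑ z, G.adjWeight v z = N.card + e := by
        have h1 : ∀ v ∈ N, ∑ z, G.adjWeight v z = 1 + ∑ w ∈ W, G.adjWeight v w * 1 := by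
          intro v hv
          have := sum_adjWeight_near htri hv fun _ => 1
          simpa using this
        rw [Finset.sum_congr rfl h1, Finset.sum_add_distrib, hswap fun _ => 1]
        simp [e]
      have k3 : ∑ v ∈ W, ∑ z, G.adjWeight v z = e + 2 * j := by
        have h1 : ∀ w ∈ W, ∑ z, G.adjWeight w z = c w + ∑ z ∈ W, G.adjWeight w z := by
          intro w hw
          have := sum_adjWeight_far G hw fun _ => 1
          simpa [c, codegree] using this
        rw [Finset.sum_congr rfl h1, Finset.sum_add_distrib]
        simp only [e, j]
        ring
      rw [G.sum_eq_near_add_far u, k1, k2, k3]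
      ring
    linarith
  have hfar : l * X ≤ ∑ w ∈ W, ∑ v ∈ N, G.adjWeight w v * x v +
      ∑ w ∈ W, ∑ z ∈ W, G.adjWeight w z * x z := by
    rw [← Finset.sum_add_distrib, Finset.mul_sum]
    refine Finset.sum_le_sum fun w hw => ?_
    have := h.le_sum w
    rwa [sum_adjWeight_far G hw] at this
  have hfar1 : l * X ≤ e + 2 * j := by
    refine hfar.trans (add_le_add (Finset.sum_le_sum fun w _ => Finset.sum_le_sum fun v _ =>
      mul_le_of_le_one_right (adjWeight_nonneg _ _ _) (h.le_one v)) ?_)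
    rw [mul_div_cancel₀ _ two_ne_zero]
    exact Finset.sum_le_sum fun w _ => Finset.sum_le_sum fun v _ =>
      mul_le_of_le_one_right (adjWeight_nonneg _ _ _) (h.le_one v)
  have hfar2 : l ^ 2 * X ≤ e * (1 + X) + l * (j * X) := by
    have k1 : l * ∑ w ∈ W, ∑ v ∈ N, G.adjWeight w v * x v ≤ e * (1 + X) := by
      rw [Finset.mul_sum, Finset.sum_mul]
      refine Finset.sum_le_sum fun w _ => ?_
      rw [Finset.mul_sum, show c w = ∑ v ∈ N, G.adjWeight w v from rfl, Finset.sum_mul]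
      refine Finset.sum_le_sum fun v hv => ?_
      rw [mul_left_comm]
      refine mul_le_mul_of_nonneg_left ((hnear v hv).trans ?_) (adjWeight_nonneg _ _ _)
      exact add_le_add le_rfl (Finset.sum_le_sum fun w _ =>
        mul_le_of_le_one_left (h.nonneg w) (adjWeight_le_one _ _ _))
    -- A vertex z of `W` has at most `j` neighbours in `W`: its degree there occurs twice in the
    -- double sum 2j, once as a row and once as a column.
    have k2 : ∑ w ∈ W, ∑ z ∈ W, G.adjWeight w z * x z ≤ j * X := by
      rw [Finset.sum_comm, Finset.mul_sum]
      refine Finset.sum_le_sum fun z hz => ?_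
      rw [← Finset.sum_mul]
      refine mul_le_mul_of_nonneg_right ?_ (h.nonneg z)
      have h1 : ∑ w ∈ W, G.adjWeight w z = ∑ w ∈ W.erase z, G.adjWeight w z := by
        rw [← Finset.add_sum_erase _ _ hz, adjWeight_of_not_adj G.irrefl, zero_add]
      have h2 : ∑ w ∈ W.erase z, G.adjWeight w z ≤
          ∑ w ∈ W.erase z, ∑ y ∈ W, G.adjWeight w y := Finset.sum_le_sum fun w _ =>
        Finset.single_le_sum (f := fun y => G.adjWeight w y)
          (fun y _ => adjWeight_nonneg _ _ _) hz
      have h3 := Finset.add_sum_erase W (fun w => ∑ y ∈ W, G.adjWeight w y) hz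
      have h4 : ∑ y ∈ W, G.adjWeight z y = ∑ w ∈ W, G.adjWeight w z :=
        Finset.sum_congr rfl fun y _ => adjWeight_comm _ _ _
      simp only [j]
      linarith
    have k3 := mul_le_mul_of_nonneg_left hfar hl0.le
    have k4 := mul_le_mul_of_nonneg_left k2 hl0.le
    calc l ^ 2 * X = l * (l * X) := by ring
      _ ≤ _ := by rw [mul_add] at k3; linarith
  refine false_of_trianglefree_bounds hl hd (N := W.card) ?_ ?_ hj0 hej hr hrX hre hX0 hXN
    hfar1 hfar2
  · rcases le_or_gt W.card 4 with h1 | h1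
    · exact .inl (by exact_mod_cast h1)
    · exact .inr (by exact_mod_cast h1)
  · rcases Nat.eq_zero_or_pos W.card with h1 | h1
    · exact .inl (by exact_mod_cast h1)
    · exact .inr (by exact_mod_cast h1)

end SimpleGraph

/-! ### Conclusion -/

namespace SimpleGraph

variable {V W : Type*} {G : SimpleGraph V}

theorem Iso.hasTwoEdgeDisjointCycles {H : SimpleGraph W} (f : G ≃g H)
    (hG : HasTwoEdgeDisjointCycles G) : HasTwoEdgeDisjointCycles H := by
  obtain ⟨u, v, c, d, hc, hd, hdisj⟩ := hG
  refine ⟨f u, f v, c.map f.toHom, d.map f.toHom, hc.map f.injective, hd.map f.injective, ?_⟩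
  rw [Walk.edges_map, Walk.edges_map]
  exact (List.disjoint_map (Sym2.map.injective f.injective)) hdisj

/-- A graph with a subinvariant vector for the eigenvalue `l ≥ 4.3` of `pendantK4` which does not
contain two edge-disjoint cycles is itself a graph `pendantK4`. -/
theorem IsSubinvariantAt.eq_pendantK4_of_not_hasTwoEdgeDisjointCycles [Fintype V] {l : ℝ}
    {x : V → ℝ} {u : V} (h : IsSubinvariantAt G l x u) (hl : 4.3 ≤ l)
    (hcard : 5 ≤ Fintype.card V) (hG : ¬ HasTwoEdgeDisjointCycles G) :
    ∃ a b c, Distinct4 u a b c ∧ G = pendantK4 u a b c := by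
  classical
  by_cases htri : ∀ a b c, G.Adj a b → G.Adj b c → ¬ G.Adj c a
  · exact (h.false_of_trianglefree hl hG htri).elim
  push Not at htri
  obtain ⟨p, q, r, hpq, hqr, hrp⟩ := htri
  by_cases hup : u = p
  · subst hup
    exact h.eq_pendantK4_of_triangle_through hcard hG hpq hqr hrp
  by_cases huq : u = q
  · subst huq
    exact h.eq_pendantK4_of_triangle_through hcard hG hqr hrp hpq
  by_cases hur : u = r
  · subst hur
    exact h.eq_pendantK4_of_triangle_through hcard hG hrp hpq hqr
  exact h.eq_pendantK4_of_triangle_avoiding hcard hG hpq hqr hrp hup huq hur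

end SimpleGraph

theorem theorem1p3 {V : Type*} [Fintype V] (G : SimpleGraph V) (hn : 17 ≤ Fintype.card V)
    (hρ : graphSpectralRadius (K4BulletStar (Fintype.card V - 4)) ≤ graphSpectralRadius G) :
    HasTwoEdgeDisjointCycles G ↔ ¬ Nonempty (G ≃g K4BulletStar (Fintype.card V - 4)) := by
  have hd := SimpleGraph.distinct4_K4BulletStar (Fintype.card V - 4)
  have hm : Fintype.card V - 4 + 4 = Fintype.card V := by omega
  have hcard := (SimpleGraph.card_K4BulletStar (Fintype.card V - 4)).trans hm
  rw [SimpleGraph.K4BulletStar_eq_pendantK4] at hρ ⊢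
  constructor
  · rintro hG ⟨f⟩
    exact SimpleGraph.not_hasTwoEdgeDisjointCycles_pendantK4 hd (f.hasTwoEdgeDisjointCycles hG)
  · intro hiso
    by_contra hG
    obtain ⟨l, hl, hroot⟩ := SimpleGraph.exists_pendantK4_root
      (show (17 : ℝ) ≤ Fintype.card V by exact_mod_cast hn)
    have hl2 : 2 < l := by linarith
    have hle := (SimpleGraph.ofReal_le_graphSpectralRadius_pendantK4 hd hl2
      (by rw [hcard]; exact hroot)).trans hρ
    obtain ⟨x, u, hx0, hxu, hx1, hx⟩ :=
      SimpleGraph.exists_subinvariant_vector (by linarith) hle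
    obtain ⟨a, b, c, hd', rfl⟩ :=
      SimpleGraph.IsSubinvariantAt.eq_pendantK4_of_not_hasTwoEdgeDisjointCycles
        ⟨hl2, hroot, hx0, hx1, hxu, hx⟩ hl (by omega) hG
    exact hiso (SimpleGraph.nonempty_pendantK4_iso hd' hd hcard.symm)
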